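/- There are absolute constants $c, C, \kappa > 0$ such that the following holds. Let $n, m \ge 0$ be integers, let $\Theta \in \mathbb{R}^{n\times n}$ be a symmetric positive semidefinite matrix that has a nonzero eigenvalue, and let $\lambda$ be its minimum nonzero eigenvalue. Let $\epsilon, \delta, \eta, \tau > 0$ be real numbers and let $\tilde\Theta = \Theta + \epsilon I$. Suppose that $m \ge C \log n$, that $\epsilon \le c\,\delta^2 \lambda / n$, that $r := \dim\ker\Theta > 2m$, and that $\ker\Theta$ is $(\delta,\eta,\tau)$-quantitatively dense, i.e. for every set $S \subseteq [n]$ with $|S| \le \tau$ and every $x \in \mathbb{R}^n$ with $\mathrm{dist}(x, \ker\Theta) = \inf_{v\in\ker\Theta}\|x-v\|_2 \le \delta \|x\|_2$, one has $\|x_{[n]\setminus S}\|_2 \ge \eta \|x\|_2$. (Here $x_U \in \mathbb{R}^U$ denotes the restriction of $x$ to the coordinates in $U \subseteq [n]$.) Fix $u \in \mathbb{R}^n$ and $P \subseteq [n]$ with $|P| \ge n - \tau$. Let $X_1,\dots,X_m \sim N(0, \tilde\Theta^{-1})$ be independent and let $X$ be the $m \times n$ matrix with rows $X_1,\dots,X_m$.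 Then $$\Pr\left[\ \inf_{a \in \mathbb{R}^m} \|u_P - (X^T a)_P\|_2 \ \ge\ \frac{\eta}{32}\,\|u_P\|_2\ \right]\ \ge\ 1 - \frac{4m}{3r} - \exp(-\kappa m).$$ -/

import Mathlib

open MeasureTheory ProbabilityTheory

/-- The restriction `x_U` of a vector `x ∈ ℝⁿ` to the coordinates in `U ⊆ [n]`,
a vector of `ℝ^U` (with its Euclidean norm). -/
def coordRestrict {n : ℕ} (U : Finset (Fin n)) (x : EuclideanSpace ℝ (Fin n)) :
    EuclideanSpace ℝ U :=
  WithLp.toLp 2 (fun i : U => x i)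

/-- A subspace `V ⊆ ℝⁿ` is `(δ, η, τ)`-quantitatively dense if every `x` with
`dist(x, V) ≤ δ ‖x‖₂` satisfies `‖x_{Cᶜ}‖₂ ≥ η ‖x‖₂` for all `C ⊆ [n]` with `|C| ≤ τ`. -/
def IsQuantitativelyDense {n : ℕ} (V : Submodule ℝ (EuclideanSpace ℝ (Fin n)))
    (δ η τ : ℝ) : Prop :=
  ∀ C : Finset (Fin n), (C.card : ℝ) ≤ τ →
    ∀ x : EuclideanSpace ℝ (Fin n),
      Metric.infDist x (V : Set (EuclideanSpace ℝ (Fin n))) ≤ δ * ‖x‖ →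
        η * ‖x‖ ≤ ‖coordRestrict Cᶜ x‖

/-- The kernel of a matrix, as a subspace of Euclidean space. -/
noncomputable def euclideanKer {n : ℕ} (Θ : Matrix (Fin n) (Fin n) ℝ) :
    Submodule ℝ (EuclideanSpace ℝ (Fin n)) :=
  LinearMap.ker (Matrix.toEuclideanLin Θ)

/-- `lam` is the minimum nonzero eigenvalue of `Θ` (in particular there is one). -/
def IsMinNonzeroEigenvalue {n : ℕ} (Θ : Matrix (Fin n) (Fin n) ℝ) (lam : ℝ) : Prop :=
  IsLeast {μ : ℝ | μ ≠ 0 ∧ Module.End.HasEigenvalue (Matrix.toEuclideanLin Θ) μ} lam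

/-- The `m × n` matrix whose rows are the samples `X 0, …, X (m - 1)`. -/
def designMatrix {m n : ℕ} (X : Fin m → EuclideanSpace ℝ (Fin n)) :
    Matrix (Fin m) (Fin n) ℝ :=
  Matrix.of fun i j => X i j

/-- The joint law of `m` independent samples from `N(0, S)` in `ℝⁿ`. -/
noncomputable def gaussianSamples (m : ℕ) {n : ℕ} (S : Matrix (Fin n) (Fin n) ℝ) :
    Measure (Fin m → EuclideanSpace ℝ (Fin n)) :=
  Measure.pi fun _ : Fin m => multivariateGaussian 0 S

/-!
Let `V = ker Θ`, `r = dim V`, and `A = Θ̃^{-1/2}`, so that `Xᵀ a = A (∑ aₖ Gₖ)` for independent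
standard Gaussian vectors `Gₖ`. Two events make the fit bad.

* *Every sample combination is near `V`.* With probability at least `1 - exp (-m)`, all
  combinations `w = ∑ aₖ Gₖ` satisfy `‖P_{Vᗮ} w‖² ≤ 8 n e⁵ ‖P_V w‖²`: the components along `V`
  are quantitatively linearly independent because `r > 2 m`, and conditionally on them the
  components along `Vᗮ` are bounded by a Chernoff estimate. As `A` scales `V` by `ε^{-1/2}` and `Vᗮ`
  by at most `λ^{-1/2}`, every `Xᵀ a` is within `(δ / 48) ‖Xᵀ a‖` of `V`.
* *A fixed vector `z` is far from the row span.* The expected squared length of the projection of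
  `z` to the row span is a quadratic form in `z`. Invariance of the Gaussian measure under
  reflections makes it diagonal in the eigenbasis of `A`; swapping coordinates shows that its
  entries increase with the eigenvalues of `A`, whose top eigenspace contains `V`. The trace is at
  most `m`, so every entry is at most `m / r`, and Markov's inequality puts `z` at distance at least
  `‖z‖ / 2` from the row span with probability at least `1 - 4 m / (3 r)`.

On both events quantitative density gives the bound, with `z` the vector of `V` that best
approximates `u` on `P` (or `u` itself when `P` is everything): if `Xᵀ a` were close to `u` on `P`,
then `z - Xᵀ a` would be a long vector near `V` that is short on `P`.
-/

open scoped RealInnerProductSpace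

section Probability

theorem measurableSet_exists_lt {ι X : Type*} [TopologicalSpace X] [MeasurableSpace X]
    [OpensMeasurableSpace X] {f g : ι → X → ℝ} (hf : ∀ a, Continuous (f a))
    (hg : ∀ a, Continuous (g a)) : MeasurableSet {x | ∃ a, f a x < g a x} := by
  rw [Set.ofPred_exists]
  exact (isOpen_iUnion fun a => isOpen_lt (hf a) (hg a)).measurableSet

theorem measureReal_prod_le_add {α β : Type*} [MeasurableSpace α] [MeasurableSpace β]
    {μ : Measure α} {ν : Measure β} [IsProbabilityMeasure μ] [IsProbabilityMeasure ν]
    {s : Set (α × β)} {t : Set α} (hs : MeasurableSet s) (ht : MeasurableSet t)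
    {c : ℝ} (hc₀ : 0 ≤ c) (hc : ∀ x ∉ t, ν.real (Prod.mk x ⁻¹' s) ≤ c) :
    (μ.prod ν).real s ≤ μ.real t + c := by
  refine ENNReal.toReal_le_of_le_ofReal (by positivity) ?_
  rw [ENNReal.ofReal_add measureReal_nonneg hc₀, ofReal_measureReal, Measure.prod_apply hs]
  calc ∫⁻ x, ν (Prod.mk x ⁻¹' s) ∂μ ≤ ∫⁻ x, (t.indicator 1 x + ENNReal.ofReal c) ∂μ := by
        refine lintegral_mono fun x => ?_
        by_cases hx : x ∈ t
        · rw [Set.indicator_of_mem hx]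
          exact prob_le_one.trans le_self_add
        · rw [← ofReal_measureReal]
          exact (ENNReal.ofReal_le_ofReal (hc x hx)).trans le_add_self
    _ = μ t + ENNReal.ofReal c := by
        rw [lintegral_add_right _ measurable_const, lintegral_indicator_one ht, lintegral_const,
          measure_univ, mul_one]

variable {Ω Ω' : Type*} [MeasurableSpace Ω] [MeasurableSpace Ω'] {μ : Measure Ω}

theorem one_sub_measureReal_sub_measureReal_le [IsProbabilityMeasure μ] {s t₁ t₂ : Set Ω}
    (h : t₁ᶜ ∩ t₂ᶜ ⊆ s) : 1 - μ.real t₁ - μ.real t₂ ≤ μ.real s := by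
  have hcover : (1 : ℝ) = μ.real (t₁ᶜ ∩ t₂ᶜ ∪ (t₁ ∪ t₂)) := by
    rw [← Set.compl_union, Set.compl_union_self, probReal_univ]
  linarith [measureReal_union_le (μ := μ) (t₁ᶜ ∩ t₂ᶜ) (t₁ ∪ t₂),
    measureReal_union_le (μ := μ) t₁ t₂, measureReal_mono (μ := μ) h]

theorem measureReal_preimage_le_map [IsFiniteMeasure μ] {f : Ω → Ω'} (hf : AEMeasurable f μ)
    (s : Set Ω') : μ.real (f ⁻¹' s) ≤ (μ.map f).real s :=
  ENNReal.toReal_mono (measure_ne_top _ _) (Measure.le_map_apply hf s)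

end Probability

variable {E F : Type*} [NormedAddCommGroup E] [InnerProductSpace ℝ E]
  [NormedAddCommGroup F] [InnerProductSpace ℝ F]

section GaussianLaws

/-- The joint law of a family of independent standard Gaussian vectors of `E` indexed by `κ`. -/
noncomputable abbrev gaussianFamily (κ E : Type*) [Fintype κ] [NormedAddCommGroup E]
    [InnerProductSpace ℝ E] [FiniteDimensional ℝ E] [MeasurableSpace E] [BorelSpace E] :
    Measure (κ → E) :=
  Measure.pi fun _ => stdGaussian E

variable [FiniteDimensional ℝ E] [MeasurableSpace E] [BorelSpace E]
  [FiniteDimensional ℝ F] [MeasurableSpace F] [BorelSpace F]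

theorem map_toLp_prod_stdGaussian :
    ((stdGaussian E).prod (stdGaussian F)).map (WithLp.toLp 2) =
      stdGaussian (WithLp 2 (E × F)) := by
  refine Measure.ext_of_charFun (funext fun t => ?_)
  rw [charFun_prod, charFun_stdGaussian, charFun_stdGaussian, charFun_stdGaussian,
    ← Complex.exp_add, ← Complex.ofReal_pow ‖t‖, WithLp.prod_norm_sq_eq_of_L2]
  push_cast
  ring_nf
  rfl

theorem measurePreserving_orthogonalDecomposition (V : Submodule ℝ E) :
    MeasurePreserving (fun x => (V.orthogonalProjectionOnto x, Vᗮ.orthogonalProjectionOnto x))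
      (stdGaussian E) ((stdGaussian V).prod (stdGaussian Vᗮ)) := by
  refine ⟨by fun_prop, (MeasurableEquiv.toLp 2 (V × Vᗮ)).map_measurableEquiv_injective ?_⟩
  rw [MeasurableEquiv.coe_toLp, map_toLp_prod_stdGaussian,
    ← stdGaussian_map V.orthogonalDecomposition, Measure.map_map (by fun_prop) (by fun_prop)]
  congr 1 with x
  simp

theorem measurePreserving_orthogonalProjectionOnto (V : Submodule ℝ E) :
    MeasurePreserving V.orthogonalProjectionOnto (stdGaussian E) (stdGaussian V) :=
  (measurePreserving_fst.comp (measurePreserving_orthogonalDecomposition V) :)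

variable {κ : Type*} [Fintype κ]

theorem measurePreserving_gaussianFamily_orthogonalDecomposition (V : Submodule ℝ E) :
    MeasurePreserving
      (fun G : κ → E => ((fun k => V.orthogonalProjectionOnto (G k)),
        fun k => Vᗮ.orthogonalProjectionOnto (G k)))
      (gaussianFamily κ E) ((gaussianFamily κ V).prod (gaussianFamily κ Vᗮ)) :=
  (measurePreserving_arrowProdEquivProdArrow V Vᗮ κ (fun _ => stdGaussian V)
    fun _ => stdGaussian Vᗮ).comp
    (measurePreserving_pi _ _ fun _ => measurePreserving_orthogonalDecomposition V)

theorem measurePreserving_gaussianFamily_linearIsometryEquiv (R : E ≃ₗᵢ[ℝ] F) :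
    MeasurePreserving (fun (G : κ → E) k => R (G k)) (gaussianFamily κ E) (gaussianFamily κ F) :=
  measurePreserving_pi _ _ fun _ => ⟨R.continuous.measurable, stdGaussian_map R⟩

theorem map_sum_smul_gaussianFamily {c : κ → ℝ} (hc : ∑ k, c k ^ 2 = 1) :
    (gaussianFamily κ E).map (fun G => ∑ k, c k • G k) = stdGaussian E := by
  have hsmul : ∀ k, Measurable fun x : E => c k • x := fun k => by fun_prop
  have hsum : (gaussianFamily κ E).map (fun G => ∑ k, c k • G k) =
      (Measure.pi fun k => (stdGaussian E).map fun x => c k • x).map fun p => ∑ k, p k := by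
    rw [← Measure.pi_map_pi fun k => (hsmul k).aemeasurable,
      Measure.map_map (by fun_prop) (by fun_prop)]
    rfl
  have (k : κ) : IsProbabilityMeasure ((stdGaussian E).map fun x => c k • x) :=
    Measure.isProbabilityMeasure_map (hsmul k).aemeasurable
  refine Measure.ext_of_charFun (funext fun t => ?_)
  rw [hsum, charFun_map_sum_pi_eq_prod, Finset.prod_apply]
  simp only [charFun_map_smul, charFun_stdGaussian, ← Complex.exp_sum, norm_smul]
  have hnorm : ∑ k, (‖c k‖ * ‖t‖) ^ 2 = ‖t‖ ^ 2 := by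
    simp only [mul_pow, ← Finset.sum_mul, Real.norm_eq_abs, sq_abs, hc, one_mul]
  rw [← Finset.sum_div, Finset.sum_neg_distrib]
  exact_mod_cast congrArg (fun s : ℝ => Complex.exp (-s / 2)) hnorm

end GaussianLaws

section GaussianConcentration

variable [FiniteDimensional ℝ E] [MeasurableSpace E] [BorelSpace E]

theorem integral_exp_mul_sq_gaussianReal {s : ℝ} (hs : s < 1 / 2) :
    ∫ x, Real.exp (s * x ^ 2) ∂gaussianReal 0 1 = (√(1 - 2 * s))⁻¹ := by
  have hdensity (x : ℝ) : gaussianPDFReal 0 1 x • Real.exp (s * x ^ 2) =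
      (√(2 * Real.pi))⁻¹ * Real.exp (-(1 / 2 - s) * x ^ 2) := by
    simp only [gaussianPDFReal, NNReal.coe_one, mul_one, sub_zero, smul_eq_mul]
    rw [mul_assoc, ← Real.exp_add]
    ring_nf
  have h : 1 - 2 * s ≠ 0 := by linarith
  simp_rw [integral_gaussianReal_eq_integral_smul one_ne_zero, hdensity]
  rw [integral_const_mul, integral_gaussian, ← Real.sqrt_inv, ← Real.sqrt_inv,
    ← Real.sqrt_mul (by positivity)]
  congr 1
  field_simp

theorem integral_exp_mul_norm_sq_stdGaussian {s : ℝ} (hs : s < 1 / 2) :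
    ∫ x, Real.exp (s * ‖x‖ ^ 2) ∂stdGaussian E = (√(1 - 2 * s))⁻¹ ^ Module.finrank ℝ E := by
  have hnorm (x : Fin (Module.finrank ℝ E) → ℝ) :
      ‖∑ i, x i • stdOrthonormalBasis ℝ E i‖ ^ 2 = ∑ i, x i ^ 2 := by
    rw [← (stdOrthonormalBasis ℝ E).equiv_apply_euclideanSpace (WithLp.toLp 2 x),
      LinearIsometryEquiv.norm_map, EuclideanSpace.real_norm_sq_eq]
  rw [stdGaussian, integral_map (Measurable.aemeasurable (by fun_prop)) (by fun_prop)]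
  simp_rw [hnorm, Finset.mul_sum, Real.exp_sum]
  rw [integral_fintype_prod_eq_pow (fun x : ℝ => Real.exp (s * x ^ 2)),
    integral_exp_mul_sq_gaussianReal hs, Fintype.card_fin]

theorem integrable_exp_mul_norm_sq_stdGaussian {s : ℝ} (hs : s < 1 / 2) :
    Integrable (fun x => Real.exp (s * ‖x‖ ^ 2)) (stdGaussian E) := by
  have : 0 < 1 - 2 * s := by linarith
  refine .of_integral_ne_zero ?_
  rw [integral_exp_mul_norm_sq_stdGaussian hs]
  positivity

theorem stdGaussian_norm_sq_le_le {c : ℝ} (hc : 0 < c) :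
    (stdGaussian E).real {x | ‖x‖ ^ 2 ≤ c * Module.finrank ℝ E} ≤
      √(Real.exp 1 * c) ^ Module.finrank ℝ E := by
  have hs : -(1 / (2 * c)) < 1 / 2 := by
    have : 0 < 1 / (2 * c) := by positivity
    linarith
  have hbase : (√(1 - 2 * -(1 / (2 * c))))⁻¹ ≤ √c := by
    rw [← Real.sqrt_inv]
    gcongr
    rw [show 1 - 2 * -(1 / (2 * c)) = (c + 1) / c by field_simp; ring, inv_div]
    exact div_le_self hc.le (by linarith)
  have hexp : Real.exp (-(-(1 / (2 * c))) * (c * Module.finrank ℝ E)) =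
      √(Real.exp 1) ^ Module.finrank ℝ E := by
    rw [← Real.exp_half, ← Real.exp_nat_mul]
    congr 1
    field_simp
  calc (stdGaussian E).real {x | ‖x‖ ^ 2 ≤ c * Module.finrank ℝ E}
      ≤ Real.exp (-(-(1 / (2 * c))) * (c * Module.finrank ℝ E)) *
          mgf (fun x => ‖x‖ ^ 2) (stdGaussian E) (-(1 / (2 * c))) :=
        measure_le_le_exp_mul_mgf _ (neg_nonpos.2 (by positivity))
          (integrable_exp_mul_norm_sq_stdGaussian hs)
    _ ≤ √(Real.exp 1) ^ Module.finrank ℝ E * √c ^ Module.finrank ℝ E := by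
        rw [hexp, mgf, integral_exp_mul_norm_sq_stdGaussian hs]
        gcongr
    _ = √(Real.exp 1 * c) ^ Module.finrank ℝ E := by
        rw [← mul_pow, Real.sqrt_mul (Real.exp_pos 1).le]

theorem stdGaussian_norm_sq_starProjection_orthogonal_le_le (U : Submodule ℝ E)
    (hU : 2 * Module.finrank ℝ U ≤ Module.finrank ℝ E) :
    (stdGaussian E).real
        {x | ‖Uᗮ.starProjection x‖ ^ 2 ≤ Real.exp (-5) / 2 * Module.finrank ℝ E} ≤
      Real.exp (-Module.finrank ℝ E) := by
  have hdim : (Module.finrank ℝ E : ℝ) ≤ 2 * Module.finrank ℝ Uᗮ := by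
    have := U.finrank_add_finrank_orthogonal
    exact_mod_cast (by omega : Module.finrank ℝ E ≤ 2 * Module.finrank ℝ Uᗮ)
  have hmeas : MeasurableSet {x : Uᗮ | ‖x‖ ^ 2 ≤ Real.exp (-5) * Module.finrank ℝ Uᗮ} :=
    measurableSet_le (by fun_prop) (by fun_prop)
  calc (stdGaussian E).real
        {x | ‖Uᗮ.starProjection x‖ ^ 2 ≤ Real.exp (-5) / 2 * Module.finrank ℝ E}
      ≤ (stdGaussian E).real
          {x | ‖Uᗮ.orthogonalProjectionOnto x‖ ^ 2 ≤ Real.exp (-5) * Module.finrank ℝ Uᗮ} := by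
        refine measureReal_mono (Set.ofPred_subset_ofPred.2 fun x hx => hx.trans ?_)
        nlinarith [Real.exp_pos (-5)]
    _ = (stdGaussian Uᗮ).real {x | ‖x‖ ^ 2 ≤ Real.exp (-5) * Module.finrank ℝ Uᗮ} :=
        (measurePreserving_orthogonalProjectionOnto Uᗮ).hasLaw.measureReal_eq hmeas
    _ ≤ √(Real.exp 1 * Real.exp (-5)) ^ Module.finrank ℝ Uᗮ :=
        stdGaussian_norm_sq_le_le (Real.exp_pos _)
    _ = Real.exp (-(2 * Module.finrank ℝ Uᗮ)) := by
        rw [← Real.exp_add, ← Real.exp_half, ← Real.exp_nat_mul]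
        ring_nf
    _ ≤ Real.exp (-Module.finrank ℝ E) := by gcongr

theorem mgf_norm_sq_stdGaussian_le :
    mgf (fun x => ‖x‖ ^ 2) (stdGaussian E) (1 / 4) ≤ Real.exp (Module.finrank ℝ E) := by
  have hsqrt : (√(1 - 2 * (1 / 4)))⁻¹ ≤ Real.exp 1 := by
    rw [← Real.sqrt_inv, Real.sqrt_le_iff]
    exact ⟨by positivity, by nlinarith [Real.add_one_le_exp 1]⟩
  rw [mgf, integral_exp_mul_norm_sq_stdGaussian (by norm_num), ← mul_one (Module.finrank ℝ E : ℝ),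
    Real.exp_nat_mul]
  gcongr

section WeightedSums

variable {κ : Type*} [Fintype κ] {Ω : Type*} [MeasurableSpace Ω] {μ : Measure Ω} {w : κ → ℝ}

theorem exp_mul_sum_le_sum_mul_exp (hw : ∀ k, 0 ≤ w k) (hw₁ : ∑ k, w k = 1) (t : ℝ) (z : κ → ℝ) :
    Real.exp (t * ∑ k, w k * z k) ≤ ∑ k, w k * Real.exp (t * z k) := by
  rw [Finset.mul_sum]
  simp_rw [mul_left_comm t]
  exact convexOn_exp.map_sum_le (fun k _ => hw k) hw₁ fun k _ => Set.mem_univ (t * z k)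

variable {Z : κ → Ω → ℝ} {t M : ℝ}

theorem integrable_exp_mul_sum_mul (hw : ∀ k, 0 ≤ w k) (hw₁ : ∑ k, w k = 1)
    (hZ : ∀ k, AEMeasurable (Z k) μ)
    (hint : ∀ k, Integrable (fun ω => Real.exp (t * Z k ω)) μ) :
    Integrable (fun ω => Real.exp (t * ∑ k, w k * Z k ω)) μ := by
  refine (integrable_finsetSum Finset.univ fun k _ => (hint k).const_mul (w k)).mono'
    (by fun_prop) (.of_forall fun ω => ?_)
  rw [Real.norm_eq_abs, Real.abs_exp]
  exact exp_mul_sum_le_sum_mul_exp hw hw₁ t fun k => Z k ω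

theorem mgf_sum_mul_le (hw : ∀ k, 0 ≤ w k) (hw₁ : ∑ k, w k = 1) (hZ : ∀ k, AEMeasurable (Z k) μ)
    (hint : ∀ k, Integrable (fun ω => Real.exp (t * Z k ω)) μ) (hM : ∀ k, mgf (Z k) μ t ≤ M) :
    mgf (fun ω => ∑ k, w k * Z k ω) μ t ≤ M := by
  calc mgf (fun ω => ∑ k, w k * Z k ω) μ t
      ≤ ∫ ω, ∑ k, w k * Real.exp (t * Z k ω) ∂μ :=
        integral_mono (integrable_exp_mul_sum_mul hw hw₁ hZ hint)
          (integrable_finsetSum _ fun k _ => (hint k).const_mul _)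
          fun ω => exp_mul_sum_le_sum_mul_exp hw hw₁ t fun k => Z k ω
    _ = ∑ k, w k * mgf (Z k) μ t := by
        rw [integral_finsetSum _ fun k _ => (hint k).const_mul _]
        simp only [integral_const_mul, mgf]
    _ ≤ ∑ k, w k * M := Finset.sum_le_sum fun k _ => mul_le_mul_of_nonneg_left (hM k) (hw k)
    _ = M := by rw [← Finset.sum_mul, hw₁, one_mul]

theorem measureReal_le_sum_mul_norm_sq_le [IsFiniteMeasure μ] {Y : κ → Ω → E}
    (hY : ∀ k, HasLaw (Y k) (stdGaussian E) μ) (hw : ∀ k, 0 ≤ w k) (hw₁ : ∑ k, w k = 1)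
    {N : ℕ} (hN : Module.finrank ℝ E ≤ N) :
    μ.real {ω | 8 * N ≤ ∑ k, w k * ‖Y k ω‖ ^ 2} ≤ Real.exp (-N) := by
  have hmeas (k : κ) : AEMeasurable (fun ω => ‖Y k ω‖ ^ 2) μ :=
    (hY k).aemeasurable.norm.pow_const 2
  have hint (k : κ) : Integrable (fun ω => Real.exp (1 / 4 * ‖Y k ω‖ ^ 2)) μ := by
    have h := integrable_exp_mul_norm_sq_stdGaussian (E := E) (s := 1 / 4) (by norm_num)
    rw [← (hY k).map_eq] at h
    exact h.comp_aemeasurable (hY k).aemeasurable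
  have hmean (k : κ) : mgf (fun ω => ‖Y k ω‖ ^ 2) μ (1 / 4) ≤ Real.exp N := by
    calc mgf (fun ω => ‖Y k ω‖ ^ 2) μ (1 / 4)
        = mgf (fun x => ‖x‖ ^ 2) (stdGaussian E) (1 / 4) :=
          (hY k).integral_comp (f := fun x => Real.exp (1 / 4 * ‖x‖ ^ 2)) (by fun_prop)
      _ ≤ Real.exp N := mgf_norm_sq_stdGaussian_le.trans (by gcongr)
  calc μ.real {ω | 8 * N ≤ ∑ k, w k * ‖Y k ω‖ ^ 2}
      ≤ Real.exp (-(1 / 4) * (8 * N)) * mgf (fun ω => ∑ k, w k * ‖Y k ω‖ ^ 2) μ (1 / 4) :=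
        measure_ge_le_exp_mul_mgf _ (by norm_num)
          (integrable_exp_mul_sum_mul hw hw₁ hmeas hint)
    _ ≤ Real.exp (-(1 / 4) * (8 * N)) * Real.exp N := by
        gcongr
        exact mgf_sum_mul_le hw hw₁ hmeas hint hmean
    _ = Real.exp (-N) := by rw [← Real.exp_add]; ring_nf

end WeightedSums

end GaussianConcentration

section LinearAlgebra

theorem norm_sq_sum_smul_le {ι : Type*} [Fintype ι] (c : ι → ℝ) (x : ι → E) :
    ‖∑ j, c j • x j‖ ^ 2 ≤ (∑ j, c j ^ 2) * ∑ j, ‖x j‖ ^ 2 := by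
  calc ‖∑ j, c j • x j‖ ^ 2 ≤ (∑ j, |c j| * ‖x j‖) ^ 2 := by
        gcongr
        exact (norm_sum_le _ _).trans_eq (by simp [norm_smul])
    _ ≤ (∑ j, |c j| ^ 2) * ∑ j, ‖x j‖ ^ 2 := Finset.sum_mul_sq_le_sq_mul_sq _ _ _
    _ = (∑ j, c j ^ 2) * ∑ j, ‖x j‖ ^ 2 := by simp only [sq_abs]

variable {κ : Type*} [Fintype κ]

theorem exists_preimages_of_sq_mul_le_norm_sq (L : (κ → ℝ) →ₗ[ℝ] E) {ρ : ℝ} (hρ : 0 < ρ)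
    (hL : ∀ i a, a i ^ 2 * ρ ≤ ‖L a‖ ^ 2) :
    ∃ (d : ℕ) (A : Fin d → κ → ℝ), (∀ j, A j ≠ 0) ∧
      ∑ j, ∑ i, A j i ^ 2 ≤ Fintype.card κ / ρ ∧
      ∀ a, ∃ c : Fin d → ℝ, a = ∑ j, c j • A j ∧ ∑ j, c j ^ 2 = ‖L a‖ ^ 2 := by
  have hinj : Function.Injective L := (injective_iff_map_eq_zero L).2 fun a ha => by
    ext i
    have h := hL i a
    rw [ha, norm_zero, zero_pow two_ne_zero] at h
    exact pow_eq_zero_iff two_ne_zero |>.1 (by nlinarith [sq_nonneg (a i)])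
  set T := LinearEquiv.ofInjective L hinj
  set f := stdOrthonormalBasis ℝ (LinearMap.range L)
  have hcoord (i : κ) : ∑ j, T.symm (f j) i ^ 2 ≤ 1 / ρ := by
    set φ : StrongDual ℝ (LinearMap.range L) :=
      (LinearMap.proj i ∘ₗ T.symm.toLinearMap).toContinuousLinearMap
    have hφ : ‖φ‖ ≤ √(1 / ρ) := φ.opNorm_le_bound (Real.sqrt_nonneg _) fun y => by
      rw [← sq_le_sq₀ (by positivity) (by positivity), mul_pow, Real.sq_sqrt (by positivity),
        one_div, inv_mul_eq_div, le_div_iff₀ hρ, Real.norm_eq_abs, sq_abs]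
      have h := hL i (T.symm y)
      rwa [← LinearEquiv.ofInjective_apply L (h := hinj), LinearEquiv.apply_symm_apply] at h
    calc ∑ j, T.symm (f j) i ^ 2 = ‖φ‖ ^ 2 := (f.norm_dual φ).symm
      _ ≤ √(1 / ρ) ^ 2 := by gcongr
      _ = 1 / ρ := Real.sq_sqrt (by positivity)
  refine ⟨_, fun j => T.symm (f j), fun j => ?_, ?_, fun a => ⟨fun j => ⟪f j, T a⟫, ?_, ?_⟩⟩
  · exact T.symm.map_ne_zero_iff.2 (f.orthonormal.ne_zero j)
  · rw [Finset.sum_comm]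
    exact (Finset.sum_le_sum fun i _ => hcoord i).trans_eq (by simp [div_eq_mul_inv])
  · simp_rw [← map_smul, ← map_sum, f.sum_repr', LinearEquiv.symm_apply_apply]
  · rw [f.sum_sq_inner_right]
    rfl

variable [FiniteDimensional ℝ E]

theorem mul_norm_starProjection_orthogonal_span_le {ι : Type*} [Fintype ι] (H : ι → E) (x : E)
    (t : ℝ) (b : ι → ℝ) :
    |t| * ‖(Submodule.span ℝ (Set.range H))ᗮ.starProjection x‖ ≤ ‖t • x + ∑ j, b j • H j‖ := by
  set U := Submodule.span ℝ (Set.range H)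
  have hmem : ∑ j, b j • H j ∈ Uᗮᗮ := U.le_orthogonal_orthogonal <|
    sum_mem fun j _ => U.smul_mem _ (Submodule.subset_span (Set.mem_range_self j))
  calc |t| * ‖Uᗮ.starProjection x‖ = ‖Uᗮ.starProjection (t • x + ∑ j, b j • H j)‖ := by
        rw [map_add, map_smul, (Submodule.starProjection_apply_eq_zero_iff _).2 hmem, add_zero,
          norm_smul, Real.norm_eq_abs]
    _ ≤ _ := Submodule.norm_starProjection_apply_le _ _

end LinearAlgebra

section LinearCombinations

variable [FiniteDimensional ℝ E] [MeasurableSpace E] [BorelSpace E]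

theorem gaussianFamily_exists_norm_sq_sum_lt_le {m : ℕ} (i : Fin m)
    (hm : 2 * m ≤ Module.finrank ℝ E) :
    (gaussianFamily (Fin m) E).real {G | ∃ a : Fin m → ℝ,
        ‖∑ k, a k • G k‖ ^ 2 < a i ^ 2 * (Real.exp (-5) / 2 * Module.finrank ℝ E)} ≤
      Real.exp (-Module.finrank ℝ E) := by
  obtain _ | m := m
  · exact i.elim0
  set ρ := Real.exp (-5) / 2 * Module.finrank ℝ E
  set s : Set ((Fin m → E) × E) :=
    {p | ∃ c : (Fin m → ℝ) × ℝ, ‖c.2 • p.2 + ∑ j, c.1 j • p.1 j‖ ^ 2 < c.2 ^ 2 * ρ}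
  have hs : MeasurableSet s :=
    measurableSet_exists_lt (fun c => by fun_prop) fun c => by fun_prop
  have hslice (H : Fin m → E) :
      (stdGaussian E).real (Prod.mk H ⁻¹' s) ≤ Real.exp (-Module.finrank ℝ E) := by
    set U := Submodule.span ℝ (Set.range H)
    have hU : Module.finrank ℝ U ≤ m := (finrank_range_le_card H).trans_eq (Fintype.card_fin m)
    refine le_trans (measureReal_mono ?_)
      (stdGaussian_norm_sq_starProjection_orthogonal_le_le U (by omega))
    rintro x ⟨⟨b, t⟩, hbt⟩
    have hle := pow_le_pow_left₀ (by positivity)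
      (mul_norm_starProjection_orthogonal_span_le H x t b) 2
    rw [mul_pow, sq_abs] at hle
    exact (lt_of_mul_lt_mul_left (hle.trans_lt hbt) (sq_nonneg t)).le
  have hsplit := Measure.measurePreserving_swap.comp
    (measurePreserving_piFinSuccAbove (fun _ => stdGaussian E) i)
  calc _ ≤ (gaussianFamily (Fin (m + 1)) E).real
          ((Prod.swap ∘ MeasurableEquiv.piFinSuccAbove (fun _ => E) i) ⁻¹' s) := by
        refine measureReal_mono ?_
        rintro G ⟨a, ha⟩
        refine ⟨(fun j => a (i.succAbove j), a i), ?_⟩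
        rw [Fin.sum_univ_succAbove _ i] at ha
        exact ha
    _ = _ := hsplit.measureReal_preimage hs.nullMeasurableSet
    _ ≤ 0 + Real.exp (-Module.finrank ℝ E) := by
        rw [← measureReal_empty]
        exact measureReal_prod_le_add hs .empty (Real.exp_pos _).le fun H _ => hslice H
    _ = _ := zero_add _

variable {κ : Type*} [Fintype κ]

theorem measureReal_eight_mul_sum_sq_le_sum_norm_sq_le {ι : Type*} [Fintype ι] [Nonempty ι]
    {A : ι → κ → ℝ} (hA : ∀ j, A j ≠ 0) {N : ℕ} (hN : Module.finrank ℝ E ≤ N) :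
    (gaussianFamily κ E).real
        {G | 8 * N * ∑ j, ∑ k, A j k ^ 2 ≤ ∑ j, ‖∑ k, A j k • G k‖ ^ 2} ≤ Real.exp (-N) := by
  set q : ι → ℝ := fun j => ∑ k, A j k ^ 2
  have hqpos (j : ι) : 0 < q j := by
    obtain ⟨k, hk⟩ := Function.ne_iff.1 (hA j)
    exact Finset.sum_pos' (fun k _ => sq_nonneg _) ⟨k, Finset.mem_univ k, sq_pos_of_ne_zero hk⟩
  have hT : 0 < ∑ j, q j := Finset.sum_pos (fun j _ => hqpos j) Finset.univ_nonempty
  have hlaw (j : ι) :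
      HasLaw (fun G => ∑ k, (A j k / √(q j)) • G k) (stdGaussian E) (gaussianFamily κ E) := by
    refine ⟨Measurable.aemeasurable (by fun_prop), map_sum_smul_gaussianFamily ?_⟩
    simp_rw [div_pow, Real.sq_sqrt (hqpos j).le, ← Finset.sum_div]
    exact div_self (hqpos j).ne'
  refine le_trans (measureReal_mono (Set.ofPred_subset_ofPred.2 fun G hG => ?_))
    (measureReal_le_sum_mul_norm_sq_le hlaw (w := fun j => q j / ∑ i, q i)
      (fun j => div_nonneg (hqpos j).le hT.le) (by rw [← Finset.sum_div, div_self hT.ne']) hN)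
  have hterm (j : ι) : q j / (∑ i, q i) * ‖∑ k, (A j k / √(q j)) • G k‖ ^ 2 =
      ‖∑ k, A j k • G k‖ ^ 2 / ∑ i, q i := by
    have hsmul : ∑ k, (A j k / √(q j)) • G k = (√(q j))⁻¹ • ∑ k, A j k • G k := by
      simp_rw [Finset.smul_sum, smul_smul, div_eq_inv_mul]
    have := (hqpos j).ne'
    rw [hsmul, norm_smul, mul_pow, Real.norm_eq_abs, sq_abs, inv_pow, Real.sq_sqrt (hqpos j).le]
    field_simp
  simp_rw [hterm, ← Finset.sum_div]
  rwa [le_div_iff₀ hT]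

end LinearCombinations

section ProjectionRatio

variable [FiniteDimensional ℝ E] [MeasurableSpace E] [BorelSpace E]

theorem gaussianFamily_exists_lt_norm_sq_sum_le {κ : Type*} [Fintype κ] (L : (κ → ℝ) →ₗ[ℝ] F)
    {ρ : ℝ} (hρ : 0 < ρ) (hL : ∀ i a, a i ^ 2 * ρ ≤ ‖L a‖ ^ 2) {N : ℕ}
    (hN : Module.finrank ℝ E ≤ N) :
    (gaussianFamily κ E).real
        {G | ∃ a, 8 * N * (Fintype.card κ / ρ) * ‖L a‖ ^ 2 < ‖∑ k, a k • G k‖ ^ 2} ≤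
      Real.exp (-N) := by
  obtain ⟨d, A, hA, hAsum, hAspan⟩ := exists_preimages_of_sq_mul_le_norm_sq L hρ hL
  have hlarge (G : κ → E) (hG : ∃ a, 8 * N * (Fintype.card κ / ρ) * ‖L a‖ ^ 2 <
      ‖∑ k, a k • G k‖ ^ 2) : 8 * N * ∑ j, ∑ k, A j k ^ 2 < ∑ j, ‖∑ k, A j k • G k‖ ^ 2 := by
    obtain ⟨a, ha⟩ := hG
    obtain ⟨c, hac, hc⟩ := hAspan a
    have hcomb : ∑ k, a k • G k = ∑ j, c j • ∑ k, A j k • G k := by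
      simp_rw [hac, Finset.sum_apply, Pi.smul_apply, smul_eq_mul, Finset.sum_smul, mul_smul,
        Finset.smul_sum]
      exact Finset.sum_comm
    rw [hcomb] at ha
    have hlt := ha.trans_le (norm_sq_sum_smul_le c fun j => ∑ k, A j k • G k)
    rw [hc, mul_comm (‖L a‖ ^ 2)] at hlt
    exact lt_of_le_of_lt (by gcongr) (lt_of_mul_lt_mul_right hlt (sq_nonneg _))
  rcases isEmpty_or_nonempty (Fin d) with _ | _
  · refine (measureReal_mono (s₂ := ∅) fun G hG => ?_).trans (by simpa using (Real.exp_pos _).le)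
    exact ((hlarge G hG).ne (by simp)).elim
  · exact (measureReal_mono (Set.ofPred_subset_ofPred.2 fun G hG => (hlarge G hG).le)).trans
      (measureReal_eight_mul_sum_sq_le_sum_norm_sq_le hA hN)

theorem add_one_mul_exp_le {m r : ℕ} (h : 2 * m < r) :
    (m : ℝ) * Real.exp (-r) + Real.exp (-r) ≤ Real.exp (-m) := by
  have hr : (2 * m + 1 : ℝ) ≤ r := by exact_mod_cast h
  calc (m : ℝ) * Real.exp (-r) + Real.exp (-r) = (m + 1) * Real.exp (-r) := by ring
    _ ≤ Real.exp (m + 1) * Real.exp (-r) := by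
        gcongr
        linarith [Real.add_one_le_exp (m + 1 : ℝ)]
    _ = Real.exp (m + 1 - r) := by rw [← Real.exp_add, sub_eq_add_neg]
    _ ≤ Real.exp (-m) := by gcongr; linarith

theorem gaussianFamily_prod_exists_lt_norm_sq_sum_le {m N : ℕ} [FiniteDimensional ℝ F]
    [MeasurableSpace F] [BorelSpace F]
    (hm : 2 * m < Module.finrank ℝ F) (hF : Module.finrank ℝ F ≤ N)
    (hE : Module.finrank ℝ E ≤ N) :
    ((gaussianFamily (Fin m) F).prod (gaussianFamily (Fin m) E)).real {p | ∃ a : Fin m → ℝ,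
        8 * N * Real.exp 5 * ‖∑ k, a k • p.1 k‖ ^ 2 < ‖∑ k, a k • p.2 k‖ ^ 2} ≤
      Real.exp (-m) := by
  set r := Module.finrank ℝ F with hr_def
  set ρ := Real.exp (-5) / 2 * r with hρ_def
  have hr : (2 * m + 1 : ℝ) ≤ r := by exact_mod_cast hm
  have hρ : 0 < ρ := mul_pos (by positivity) (by linarith [m.cast_nonneg (α := ℝ)])
  set t : Set (Fin m → F) := ⋃ i, {H | ∃ a : Fin m → ℝ, ‖∑ k, a k • H k‖ ^ 2 < a i ^ 2 * ρ}
  have ht : (gaussianFamily (Fin m) F).real t ≤ m * Real.exp (-r) :=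
    (measureReal_iUnion_fintype_le _).trans <|
      (Finset.sum_le_sum fun i _ => gaussianFamily_exists_norm_sq_sum_lt_le i hm.le).trans_eq
        (by simp [hr_def])
  have hmρ : m / ρ ≤ Real.exp 5 := by
    rw [div_le_iff₀ hρ, hρ_def, ← mul_assoc, mul_div_assoc', ← Real.exp_add]
    norm_num
    linarith
  have hslice (H : Fin m → F) (hH : H ∉ t) :
      (gaussianFamily (Fin m) E).real {K | ∃ a : Fin m → ℝ,
        8 * N * Real.exp 5 * ‖∑ k, a k • H k‖ ^ 2 < ‖∑ k, a k • K k‖ ^ 2} ≤ Real.exp (-r) := by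
    have hL : ∀ i a, a i ^ 2 * ρ ≤ ‖Fintype.linearCombination ℝ H a‖ ^ 2 := fun i a => by
      by_contra! hlt
      exact hH (Set.mem_iUnion.2 ⟨i, a, hlt⟩)
    calc _ ≤ Real.exp (-N) := by
          refine (measureReal_mono (Set.ofPred_subset_ofPred.2 ?_)).trans
            (gaussianFamily_exists_lt_norm_sq_sum_le _ hρ hL hE)
          rintro K ⟨a, ha⟩
          refine ⟨a, lt_of_le_of_lt ?_ ha⟩
          rw [Fintype.card_fin]
          gcongr
          exact le_rfl
      _ ≤ Real.exp (-r) := by gcongr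
  have htmeas : MeasurableSet t := MeasurableSet.iUnion fun i =>
    measurableSet_exists_lt (fun a => by fun_prop) fun a => by fun_prop
  exact (measureReal_prod_le_add
      (measurableSet_exists_lt (fun a => by fun_prop) fun a => by fun_prop)
      htmeas (Real.exp_pos _).le hslice).trans
    ((add_le_add_left ht _).trans (add_one_mul_exp_le hm))

theorem gaussianFamily_exists_projection_ratio_le (V : Submodule ℝ E) {m : ℕ}
    (hm : 2 * m < Module.finrank ℝ V) :
    (gaussianFamily (Fin m) E).real {G | ∃ a : Fin m → ℝ,
        8 * Module.finrank ℝ E * Real.exp 5 * ‖V.starProjection (∑ k, a k • G k)‖ ^ 2 <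
          ‖Vᗮ.starProjection (∑ k, a k • G k)‖ ^ 2} ≤
      Real.exp (-m) := by
  have h := gaussianFamily_prod_exists_lt_norm_sq_sum_le hm V.finrank_le Vᗮ.finrank_le
  rw [← (measurePreserving_gaussianFamily_orthogonalDecomposition V).hasLaw.measureReal_eq] at h
  · refine le_trans (measureReal_mono (Set.ofPred_subset_ofPred.2 ?_)) h
    rintro G ⟨a, ha⟩
    refine ⟨a, ?_⟩
    simpa only [← map_smul, ← map_sum, Submodule.starProjection_apply, Submodule.coe_norm] using ha
  · exact measurableSet_exists_lt (fun a => by fun_prop) fun a => by fun_prop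

end ProjectionRatio

section GaussianImage

variable {κ : Type*}

/-- The span of the images under `A` of the vectors of the family `G`. -/
def imageSpan (A : E →L[ℝ] E) (G : κ → E) : Submodule ℝ E :=
  Submodule.span ℝ (Set.range fun k => A (G k))

theorem mem_imageSpan_iff [Fintype κ] {A : E →L[ℝ] E} {G : κ → E} {x : E} :
    x ∈ imageSpan A G ↔ ∃ a : κ → ℝ, A (∑ k, a k • G k) = x := by
  simp [imageSpan, Submodule.mem_span_range_iff_exists_fun]

variable [FiniteDimensional ℝ E]

theorem lt_norm_sq_starProjection_iff {S : Submodule ℝ E} {u : E} {c : ℝ} :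
    c < ‖S.starProjection u‖ ^ 2 ↔ ∃ w ∈ S, ‖u - w‖ ^ 2 < ‖u‖ ^ 2 - c := by
  have hpyth := Submodule.norm_sq_eq_add_norm_sq_starProjection u S
  constructor
  · refine fun h => ⟨S.starProjection u, Submodule.starProjection_apply_mem _ _, ?_⟩
    rw [← S.starProjection_orthogonal_val]
    linarith
  · rintro ⟨w, hw, hlt⟩
    have hproj : Sᗮ.starProjection (u - w) = Sᗮ.starProjection u := by
      rw [map_sub, (Submodule.starProjection_apply_eq_zero_iff _).2
        (S.le_orthogonal_orthogonal hw), sub_zero]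
    have hle := pow_le_pow_left₀ (norm_nonneg _) (Sᗮ.norm_starProjection_apply_le (u - w)) 2
    rw [hproj] at hle
    linarith

theorem sum_norm_sq_starProjection_orthonormalBasis {ι : Type*} [Fintype ι]
    (b : OrthonormalBasis ι ℝ E) (S : Submodule ℝ E) :
    ∑ i, ‖S.starProjection (b i)‖ ^ 2 = Module.finrank ℝ S := by
  have hproj : LinearMap.IsProj S (S.starProjection : E →ₗ[ℝ] E) :=
    ⟨S.starProjection_apply_mem, fun x hx => Submodule.starProjection_eq_self_iff.2 hx⟩
  rw [← hproj.trace, LinearMap.trace_eq_sum_inner _ b]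
  refine Finset.sum_congr rfl fun i _ => ?_
  rw [ContinuousLinearMap.coe_coe, ← real_inner_self_eq_norm_sq,
    Submodule.inner_starProjection_left_eq_right, Submodule.starProjection_eq_self_iff.2
      (S.starProjection_apply_mem _)]

theorem norm_starProjection_imageSpan_le [Finite κ] (A : E →L[ℝ] E) (R : E ≃ₗᵢ[ℝ] E) {u u' : E}
    (hu : ‖u‖ = ‖u'‖) (hR : ∀ g, ∃ t : ℝ, ‖u' - A (t • R g)‖ ≤ ‖u - A g‖) (G : κ → E) :
    ‖(imageSpan A G).starProjection u‖ ^ 2 ≤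
      ‖(imageSpan A fun k => R (G k)).starProjection u'‖ ^ 2 := by
  cases nonempty_fintype κ
  refine le_of_forall_lt fun c hc => ?_
  obtain ⟨_, hx, hlt⟩ := lt_norm_sq_starProjection_iff.1 hc
  obtain ⟨a, rfl⟩ := mem_imageSpan_iff.1 hx
  obtain ⟨t, ht⟩ := hR (∑ k, a k • G k)
  refine lt_norm_sq_starProjection_iff.2 ⟨_, mem_imageSpan_iff.2 ⟨fun k => t * a k, rfl⟩, ?_⟩
  rw [← hu]
  refine lt_of_le_of_lt (pow_le_pow_left₀ (norm_nonneg _) ?_ 2) hlt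
  simpa [map_sum, mul_smul, Finset.smul_sum] using ht

variable [MeasurableSpace E] [BorelSpace E]

theorem measurable_norm_sq_starProjection_imageSpan [Finite κ] (A : E →L[ℝ] E) (u : E) :
    Measurable fun G : κ → E => ‖(imageSpan A G).starProjection u‖ ^ 2 := by
  cases nonempty_fintype κ
  refine measurable_of_Ioi fun c => ?_
  have hpre : (fun G : κ → E => ‖(imageSpan A G).starProjection u‖ ^ 2) ⁻¹' Set.Ioi c =
      {G | ∃ a : κ → ℝ, ‖u - A (∑ k, a k • G k)‖ ^ 2 < ‖u‖ ^ 2 - c} := by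
    ext G
    simp [lt_norm_sq_starProjection_iff, mem_imageSpan_iff]
  rw [hpre]
  exact measurableSet_exists_lt (fun _ => by fun_prop) fun _ => by fun_prop

variable [Fintype κ]

theorem integrable_norm_sq_starProjection_imageSpan (A : E →L[ℝ] E) (u : E) :
    Integrable (fun G => ‖(imageSpan A G).starProjection u‖ ^ 2) (gaussianFamily κ E) := by
  refine .of_bound (measurable_norm_sq_starProjection_imageSpan A u).aestronglyMeasurable
    (‖u‖ ^ 2) (.of_forall fun G => ?_)
  rw [Real.norm_of_nonneg (by positivity)]
  gcongr
  exact Submodule.norm_starProjection_apply_le _ _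

variable (κ) in
/-- The expected squared length of the projection of `u` to the span of the images under `A` of
independent standard Gaussian vectors indexed by `κ`. -/
noncomputable def expectedProjection (A : E →L[ℝ] E) (u : E) : ℝ :=
  ∫ G, ‖(imageSpan A G).starProjection u‖ ^ 2 ∂gaussianFamily κ E

theorem expectedProjection_smul (A : E →L[ℝ] E) (c : ℝ) (u : E) :
    expectedProjection κ A (c • u) = c ^ 2 * expectedProjection κ A u := by
  simp_rw [expectedProjection, map_smul, norm_smul, mul_pow, integral_const_mul, Real.norm_eq_abs,
    sq_abs]

theorem expectedProjection_add_add_sub (A : E →L[ℝ] E) (u v : E) :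
    expectedProjection κ A (u + v) + expectedProjection κ A (u - v) =
      2 * (expectedProjection κ A u + expectedProjection κ A v) := by
  simp_rw [expectedProjection]
  rw [← integral_add, ← integral_add, ← integral_const_mul]
  · congr 1 with G
    simpa only [map_add, map_sub, sq] using parallelogram_law_with_norm ℝ _ _
  all_goals exact integrable_norm_sq_starProjection_imageSpan A _

theorem expectedProjection_le_of_isometry (A : E →L[ℝ] E) (R : E ≃ₗᵢ[ℝ] E) {u u' : E}
    (hu : ‖u‖ = ‖u'‖) (hR : ∀ g, ∃ t : ℝ, ‖u' - A (t • R g)‖ ≤ ‖u - A g‖) :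
    expectedProjection κ A u ≤ expectedProjection κ A u' := by
  calc expectedProjection κ A u
      ≤ ∫ G, ‖(imageSpan A fun k => R (G k)).starProjection u'‖ ^ 2 ∂gaussianFamily κ E :=
        integral_mono (integrable_norm_sq_starProjection_imageSpan A u)
          ((measurePreserving_gaussianFamily_linearIsometryEquiv R).integrable_comp_of_integrable
            (integrable_norm_sq_starProjection_imageSpan A u'))
          (norm_starProjection_imageSpan_le A R hu hR)
    _ = expectedProjection κ A u' :=
        (measurePreserving_gaussianFamily_linearIsometryEquiv R).hasLaw.integral_comp
          (measurable_norm_sq_starProjection_imageSpan A u').aestronglyMeasurable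

theorem expectedProjection_map_of_involutive (A : E →L[ℝ] E) (R : E ≃ₗᵢ[ℝ] E)
    (hR : Function.Involutive R) (hA : Function.Commute R A) (u : E) :
    expectedProjection κ A (R u) = expectedProjection κ A u := by
  have hle (v : E) : expectedProjection κ A v ≤ expectedProjection κ A (R v) :=
    expectedProjection_le_of_isometry A R (R.norm_map v).symm fun g =>
      ⟨1, by rw [one_smul, ← hA.eq, ← map_sub, R.norm_map]⟩
  exact le_antisymm ((hle (R u)).trans_eq (by rw [hR u])) (hle u)

end GaussianImage

section DiagonalImage

variable {ι κ : Type*} [Fintype ι] [Fintype κ] {b : OrthonormalBasis ι ℝ E} {σ : ι → ℝ}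
  {A : E →L[ℝ] E}

theorem inner_orthonormalBasis_map (hA : ∀ i, A (b i) = σ i • b i) (i : ι) (x : E) :
    ⟪b i, A x⟫ = σ i * ⟪b i, x⟫ := by
  classical
  conv_lhs => rw [← b.sum_repr' x]
  simp [hA, inner_sum, inner_smul_right, b.inner_eq_ite, mul_comm]

theorem reflection_orthonormalBasis_commute (hA : ∀ i, A (b i) = σ i • b i) (j : ι) :
    Function.Commute (ℝ ∙ b j)ᗮ.reflection A := by
  have hcomp : (ℝ ∙ b j)ᗮ.reflection.toLinearMap ∘ₗ A.toLinearMap =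
      A.toLinearMap ∘ₗ (ℝ ∙ b j)ᗮ.reflection.toLinearMap := b.toBasis.ext fun i => by
    rcases eq_or_ne i j with rfl | hij
    · simp [hA, Submodule.reflection_orthogonalComplement_singleton_eq_neg]
    · have hfix : (ℝ ∙ b j)ᗮ.reflection (b i) = b i :=
        Submodule.reflection_mem_subspace_eq_self
          (Submodule.mem_orthogonal_singleton_iff_inner_right.2 (b.inner_eq_zero hij.symm))
      simp [hA, hfix]
  exact fun x => LinearMap.congr_fun hcomp x

theorem norm_orthonormalBasis_sub_map_swap_le [DecidableEq ι] (hA : ∀ i, A (b i) = σ i • b i)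
    {i j : ι} (hj : 0 ≤ σ j) (hij : σ j ≤ σ i) (g : E) :
    ‖b i - A ((σ j / σ i) • b.equiv b (Equiv.swap i j) g)‖ ≤ ‖b j - A g‖ := by
  have hinner (l : ι) : ⟪b (Equiv.swap i j l), b.equiv b (Equiv.swap i j) g⟫ = ⟪b l, g⟫ := by
    rw [← b.equiv_apply_basis b, LinearIsometryEquiv.inner_map_map]
  rw [← sq_le_sq₀ (norm_nonneg _) (norm_nonneg _), ← b.sum_sq_inner_right, ← b.sum_sq_inner_right,
    ← Equiv.sum_comp (Equiv.swap i j)]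
  have hratio : |σ j / σ i| ≤ 1 := by
    rw [abs_of_nonneg (div_nonneg hj (hj.trans hij))]
    exact div_le_one_of_le₀ hij (hj.trans hij)
  refine Finset.sum_le_sum fun l _ => ?_
  simp only [inner_sub_right, inner_orthonormalBasis_map hA, inner_smul_right, hinner,
    b.inner_eq_ite, ← mul_assoc]
  rcases eq_or_ne l j with rfl | hlj
  · have hcancel : σ i * (σ l / σ i) = σ l :=
      mul_div_cancel_of_imp' fun h => le_antisymm (hij.trans_eq h) hj
    simp [hcancel]
  · have hswap : |σ (Equiv.swap i j l)| ≤ |σ l| := by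
      rcases eq_or_ne l i with rfl | hli
      · rw [Equiv.swap_apply_left]
        exact abs_le_abs_of_nonneg hj hij
      · rw [Equiv.swap_apply_of_ne_of_ne hli hlj]
    rw [if_neg hlj, if_neg (by rwa [Equiv.swap_apply_eq_iff, Equiv.swap_apply_left]), zero_sub,
      zero_sub, neg_sq, neg_sq, sq_le_sq, abs_mul, abs_mul, abs_mul]
    gcongr
    exact (mul_le_of_le_one_right (abs_nonneg _) hratio).trans hswap

variable [FiniteDimensional ℝ E] [MeasurableSpace E] [BorelSpace E]

theorem expectedProjection_add_smul_orthonormalBasis (hA : ∀ i, A (b i) = σ i • b i) {j : ι}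
    {u : E} (hu : ⟪b j, u⟫ = 0) (c : ℝ) :
    expectedProjection κ A (u + c • b j) =
      expectedProjection κ A u + c ^ 2 * expectedProjection κ A (b j) := by
  have hreflect : (ℝ ∙ b j)ᗮ.reflection (u + c • b j) = u - c • b j := by
    rw [map_add, map_smul, Submodule.reflection_orthogonalComplement_singleton_eq_neg,
      Submodule.reflection_mem_subspace_eq_self
        (Submodule.mem_orthogonal_singleton_iff_inner_right.2 hu), smul_neg, sub_eq_add_neg]
  have hsub : expectedProjection κ A (u - c • b j) = expectedProjection κ A (u + c • b j) := by
    rw [← hreflect]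
    exact expectedProjection_map_of_involutive A _ (Submodule.reflection_involutive _)
      (reflection_orthonormalBasis_commute hA j) _
  have hpar := expectedProjection_add_add_sub (κ := κ) A u (c • b j)
  rw [hsub, expectedProjection_smul] at hpar
  linarith

theorem expectedProjection_sum_smul_orthonormalBasis (hA : ∀ i, A (b i) = σ i • b i)
    (c : ι → ℝ) (s : Finset ι) :
    expectedProjection κ A (∑ i ∈ s, c i • b i) =
      ∑ i ∈ s, c i ^ 2 * expectedProjection κ A (b i) := by
  classical
  induction s using Finset.induction_on with
  | empty => simp [expectedProjection]
  | insert j s hj ih =>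
    have horth : ⟪b j, ∑ i ∈ s, c i • b i⟫ = 0 := by
      rw [inner_sum]
      refine Finset.sum_eq_zero fun i hi => ?_
      rw [inner_smul_right, b.inner_eq_zero (ne_of_mem_of_not_mem hi hj).symm, mul_zero]
    rw [Finset.sum_insert hj, Finset.sum_insert hj, add_comm,
      expectedProjection_add_smul_orthonormalBasis hA horth, ih, add_comm]

theorem expectedProjection_eq_sum (hA : ∀ i, A (b i) = σ i • b i) (u : E) :
    expectedProjection κ A u = ∑ i, ⟪b i, u⟫ ^ 2 * expectedProjection κ A (b i) := by
  conv_lhs => rw [← b.sum_repr' u]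
  exact expectedProjection_sum_smul_orthonormalBasis hA _ _

theorem sum_expectedProjection_orthonormalBasis_le (b : OrthonormalBasis ι ℝ E) (A : E →L[ℝ] E) :
    ∑ i, expectedProjection κ A (b i) ≤ Fintype.card κ := by
  simp_rw [expectedProjection]
  rw [← integral_finsetSum _ fun i _ => integrable_norm_sq_starProjection_imageSpan A (b i)]
  simp_rw [sum_norm_sq_starProjection_orthonormalBasis]
  refine (integral_mono_of_nonneg (.of_forall fun G => Nat.cast_nonneg _)
    (integrable_const (Fintype.card κ : ℝ)) (.of_forall fun G => ?_)).trans_eq (by simp)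
  exact Nat.cast_le.2 (finrank_range_le_card _)

theorem expectedProjection_orthonormalBasis_le (hA : ∀ i, A (b i) = σ i • b i)
    {i j : ι} (hj : 0 ≤ σ j) (hij : σ j ≤ σ i) :
    expectedProjection κ A (b j) ≤ expectedProjection κ A (b i) := by
  classical
  exact expectedProjection_le_of_isometry A (b.equiv b (Equiv.swap i j)) (by simp)
    fun g => ⟨_, norm_orthonormalBasis_sub_map_swap_le hA hj hij g⟩

theorem expectedProjection_le (hA : ∀ i, A (b i) = σ i • b i) (hσ : ∀ i, 0 ≤ σ i) {s : Finset ι}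
    (hs : s.Nonempty) (hmax : ∀ i ∈ s, ∀ j, σ j ≤ σ i) (u : E) :
    expectedProjection κ A u ≤ Fintype.card κ / s.card * ‖u‖ ^ 2 := by
  have hbasis (j : ι) : expectedProjection κ A (b j) ≤ Fintype.card κ / s.card := by
    rw [le_div_iff₀' (by exact_mod_cast hs.card_pos), ← nsmul_eq_mul]
    calc s.card • expectedProjection κ A (b j) ≤ ∑ i ∈ s, expectedProjection κ A (b i) :=
          Finset.card_nsmul_le_sum _ _ _ fun i hi =>
            expectedProjection_orthonormalBasis_le hA (hσ j) (hmax i hi j)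
      _ ≤ ∑ i, expectedProjection κ A (b i) :=
          Finset.sum_le_univ_sum_of_nonneg fun i => integral_nonneg fun G => by positivity
      _ ≤ Fintype.card κ := sum_expectedProjection_orthonormalBasis_le b A
  calc expectedProjection κ A u = ∑ i, ⟪b i, u⟫ ^ 2 * expectedProjection κ A (b i) :=
        expectedProjection_eq_sum hA u
    _ ≤ ∑ i, ⟪b i, u⟫ ^ 2 * (Fintype.card κ / s.card) := by gcongr with i; exact hbasis i
    _ = Fintype.card κ / s.card * ‖u‖ ^ 2 := by
        rw [← Finset.sum_mul, b.sum_sq_inner_right, mul_comm]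

theorem gaussianFamily_exists_norm_sub_map_lt_le (hA : ∀ i, A (b i) = σ i • b i)
    (hσ : ∀ i, 0 ≤ σ i) {s : Finset ι} (hs : s.Nonempty) (hmax : ∀ i ∈ s, ∀ j, σ j ≤ σ i) (u : E) :
    (gaussianFamily κ E).real {G | ∃ a : κ → ℝ, ‖u - A (∑ k, a k • G k)‖ < ‖u‖ / 2} ≤
      4 * Fintype.card κ / (3 * s.card) := by
  rcases eq_or_ne u 0 with rfl | hu
  · refine (measureReal_mono (s₂ := ∅) ?_).trans (by rw [measureReal_empty]; positivity)
    rintro G ⟨a, ha⟩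
    simp only [map_sum, map_smul, zero_sub, norm_neg, norm_zero, zero_div] at ha
    exact ha.not_ge (norm_nonneg _)
  have hsub : {G : κ → E | ∃ a : κ → ℝ, ‖u - A (∑ k, a k • G k)‖ < ‖u‖ / 2} ⊆
      {G | 3 / 4 * ‖u‖ ^ 2 ≤ ‖(imageSpan A G).starProjection u‖ ^ 2} := by
    rintro G ⟨a, ha⟩
    refine (lt_norm_sq_starProjection_iff.2 ⟨_, mem_imageSpan_iff.2 ⟨a, rfl⟩, ?_⟩).le
    nlinarith [norm_nonneg (u - A (∑ k, a k • G k))]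
  have hmarkov := (mul_meas_ge_le_integral_of_nonneg (.of_forall fun G => by positivity)
    (integrable_norm_sq_starProjection_imageSpan A u) (3 / 4 * ‖u‖ ^ 2)).trans
    (expectedProjection_le (κ := κ) hA hσ hs hmax u)
  refine (measureReal_mono hsub).trans ?_
  have hpos : 0 < 3 / 4 * ‖u‖ ^ 2 := by positivity
  rw [← le_div_iff₀' hpos] at hmarkov
  refine hmarkov.trans_eq ?_
  field_simp

end DiagonalImage

section TestVector

variable [FiniteDimensional ℝ E]

theorem exists_mem_forall_norm_map_sub_le (T : E →ₗ[ℝ] F) (V : Submodule ℝ E) (u : E) :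
    ∃ z ∈ V, ∀ v ∈ V, ‖T u - T z‖ ≤ ‖T u - T v‖ ∧ ‖T z - T v‖ ≤ ‖T u - T v‖ := by
  set W := V.map T
  obtain ⟨z, hz, hzW⟩ := Submodule.mem_map.1 (W.starProjection_apply_mem (T u))
  refine ⟨z, hz, fun v hv => ?_⟩
  have hproj : W.starProjection (T u - T v) = T z - T v := by
    rw [map_sub, hzW, Submodule.starProjection_eq_self_iff.2 (Submodule.mem_map_of_mem hv)]
  have horth : Wᗮ.starProjection (T u - T v) = T u - T z := by
    rw [W.starProjection_orthogonal_val, hproj, sub_sub_sub_cancel_right]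
  rw [← horth, ← hproj]
  exact ⟨Submodule.norm_starProjection_apply_le _ _, Submodule.norm_starProjection_apply_le _ _⟩

theorem exists_mem_forall_mul_norm_map_le (T : E →ₗ[ℝ] F) (hT : ∀ x, ‖T x‖ ≤ ‖x‖)
    (V : Submodule ℝ E) {δ θ : ℝ} (hδ : 0 ≤ δ) (hδθ : δ ≤ 2 * θ) (hθ : θ ≤ 1)
    (hdense : ∀ x, Metric.infDist x V ≤ δ * ‖x‖ → θ * ‖x‖ ≤ ‖T x‖) (u : E) :
    ∃ z, ∀ x, ∀ v ∈ V, ‖z‖ / 2 ≤ ‖z - x‖ → ‖x - v‖ ≤ δ / 24 * ‖x‖ →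
      θ / 32 * ‖T u‖ ≤ ‖T u - T x‖ := by
  obtain ⟨z, hz, hbest⟩ := exists_mem_forall_norm_map_sub_le T V u
  refine ⟨z, fun x v hv hfar hclose => ?_⟩
  obtain ⟨huz, hzv⟩ := hbest v hv
  have hθ₀ : 0 ≤ θ := by linarith
  have hx : ‖x‖ ≤ 3 * ‖z - x‖ := by
    linarith [norm_sub_norm_le x z, norm_sub_rev x z]
  have hw : ‖x - v‖ ≤ θ / 4 * ‖z - x‖ := by
    calc ‖x - v‖ ≤ δ / 24 * ‖x‖ := hclose
      _ ≤ 2 * θ / 24 * (3 * ‖z - x‖) := by gcongr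
      _ = θ / 4 * ‖z - x‖ := by ring
  have huv : ‖T u - T v‖ ≤ ‖T u - T x‖ + ‖x - v‖ := by
    calc ‖T u - T v‖ ≤ ‖T u - T x‖ + ‖T x - T v‖ := norm_sub_le_norm_sub_add_norm_sub _ _ _
      _ ≤ _ := by rw [← map_sub T x v]; gcongr; exact hT _
  have hzx : θ * ‖z - x‖ ≤ ‖T z - T v‖ + ‖x - v‖ := by
    have hdist : Metric.infDist (z - x) V ≤ δ * ‖z - x‖ := by
      calc Metric.infDist (z - x) V ≤ dist (z - x) (z - v) :=
            Metric.infDist_le_dist_of_mem (V.sub_mem hz hv)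
        _ = ‖x - v‖ := by rw [dist_sub_left, dist_eq_norm]
        _ ≤ δ / 24 * (3 * ‖z - x‖) := hclose.trans (by gcongr)
        _ ≤ δ * ‖z - x‖ := by nlinarith [mul_nonneg hδ (norm_nonneg (z - x))]
    calc θ * ‖z - x‖ ≤ ‖T z - T x‖ := by rw [← map_sub]; exact hdense _ hdist
      _ ≤ ‖T z - T v‖ + ‖T v - T x‖ := norm_sub_le_norm_sub_add_norm_sub _ _ _
      _ ≤ _ := by rw [← map_sub T v, norm_sub_rev x]; gcongr; exact hT _
  have hD : θ / 2 * ‖z - x‖ ≤ ‖T u - T x‖ := by linarith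
  calc θ / 32 * ‖T u‖ ≤ θ / 32 * (‖T u - T z‖ + ‖T z‖) := by
        gcongr
        simpa using norm_add_le (T u - T z) (T z)
    _ ≤ (‖T u - T z‖ + 2 * (θ * ‖z - x‖)) / 32 := by
        nlinarith [hT z, mul_le_mul_of_nonneg_right hθ (norm_nonneg (T u - T z))]
    _ ≤ ‖T u - T x‖ := by linarith [hD, norm_nonneg (T u - T x)]

end TestVector

section QuantitativeDensity

variable {n : ℕ}

/-- The restriction of vectors to the coordinates in `U`, as a linear map. -/
def coordRestrictLin (U : Finset (Fin n)) :
    EuclideanSpace ℝ (Fin n) →ₗ[ℝ] EuclideanSpace ℝ U where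
  toFun := coordRestrict U
  map_add' _ _ := rfl
  map_smul' _ _ := rfl

theorem norm_coordRestrict_sq (U : Finset (Fin n)) (x : EuclideanSpace ℝ (Fin n)) :
    ‖coordRestrict U x‖ ^ 2 = ∑ i ∈ U, x i ^ 2 := by
  rw [EuclideanSpace.real_norm_sq_eq]
  exact Finset.sum_coe_sort U fun i => x i ^ 2

theorem norm_coordRestrict_le (U : Finset (Fin n)) (x : EuclideanSpace ℝ (Fin n)) :
    ‖coordRestrict U x‖ ≤ ‖x‖ := by
  rw [← sq_le_sq₀ (norm_nonneg _) (norm_nonneg _), norm_coordRestrict_sq,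
    EuclideanSpace.real_norm_sq_eq]
  exact Finset.sum_le_univ_sum_of_nonneg fun _ => sq_nonneg _

theorem norm_coordRestrict_univ (x : EuclideanSpace ℝ (Fin n)) :
    ‖coordRestrict Finset.univ x‖ = ‖x‖ := by
  rw [← sq_eq_sq₀ (norm_nonneg _) (norm_nonneg _), norm_coordRestrict_sq,
    EuclideanSpace.real_norm_sq_eq]

theorem exists_coordRestrict_eq_zero (U : Finset (Fin n)) (x : EuclideanSpace ℝ (Fin n)) :
    ∃ y, coordRestrict U y = 0 ∧ ‖x - y‖ = ‖coordRestrict U x‖ := by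
  refine ⟨WithLp.toLp 2 fun i => if i ∈ U then 0 else x i, ?_, ?_⟩
  · ext ⟨i, hi⟩
    simp [coordRestrict]
  · rw [← sq_eq_sq₀ (norm_nonneg _) (norm_nonneg _), norm_coordRestrict_sq,
      EuclideanSpace.real_norm_sq_eq, ← Finset.sum_subset U.subset_univ fun i _ hi => by simp [hi]]
    exact Finset.sum_congr rfl fun i hi => by simp [hi]

namespace IsQuantitativelyDense

variable {V : Submodule ℝ (EuclideanSpace ℝ (Fin n))} {δ δ' η η' τ : ℝ}

theorem anti (h : IsQuantitativelyDense V δ η τ) (hδ : δ' ≤ δ) :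
    IsQuantitativelyDense V δ' η τ :=
  fun C hC x hx => h C hC x (hx.trans (by gcongr))

protected theorem max (h : IsQuantitativelyDense V δ η τ) (h' : IsQuantitativelyDense V δ η' τ) :
    IsQuantitativelyDense V δ (max η η') τ := fun C hC x hx => by
  rw [max_mul_of_nonneg _ _ (norm_nonneg x)]
  exact max_le (h C hC x hx) (h' C hC x hx)

theorem le_one (h : IsQuantitativelyDense V δ η τ) (hδ : 0 ≤ δ) (hτ : 0 ≤ τ) (hV : V ≠ ⊥) :
    η ≤ 1 := by
  obtain ⟨v, hv, hv₀⟩ := V.ne_bot_iff.1 hV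
  have hle := h ∅ (by simpa using hτ) v
    ((Metric.infDist_zero_of_mem (SetLike.mem_coe.2 hv)).trans_le (by positivity))
  refine le_of_mul_le_mul_right ?_ (norm_pos_iff.2 hv₀)
  rw [one_mul]
  exact hle.trans (norm_coordRestrict_le _ v)

theorem lt_one (h : IsQuantitativelyDense V δ η τ) (hη : 0 < η) {C : Finset (Fin n)}
    (hC : C.card ≤ τ) (hne : C.Nonempty) : δ < 1 := by
  obtain ⟨i, hi⟩ := hne
  by_contra! hδ
  have hle := h C hC (EuclideanSpace.single i 1) <|
    (Metric.infDist_le_dist_of_mem (SetLike.mem_coe.2 V.zero_mem)).trans (by simpa using hδ)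
  have hzero : coordRestrict Cᶜ (EuclideanSpace.single i (1 : ℝ)) = 0 := by
    ext ⟨j, hj⟩
    have hji : j ≠ i := (ne_of_mem_of_not_mem hi (Finset.mem_compl.1 hj)).symm
    simp [coordRestrict, hji]
  rw [hzero, norm_zero, PiLp.norm_single, norm_one, mul_one] at hle
  linarith

-- Zeroing the coordinates off `C` keeps a point near `V`, where the original `η` applies.
theorem half_quarter (h : IsQuantitativelyDense V δ η τ) (hδ₀ : 0 ≤ δ) (hδ₁ : δ ≤ 1)
    (hη : 0 < η) : IsQuantitativelyDense V (δ / 2) (δ / 4) τ := fun C hC x hx => by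
  by_contra! hlt
  obtain ⟨y, hy, hxy⟩ := exists_coordRestrict_eq_zero Cᶜ x
  have hxy_le : ‖x‖ - ‖y‖ ≤ ‖x - y‖ := norm_sub_norm_le x y
  have hdist : Metric.infDist y V ≤ δ * ‖y‖ := by
    have hinf := Metric.infDist_le_infDist_add_dist (s := (V : Set _)) (x := y) (y := x)
    rw [dist_comm, dist_eq_norm] at hinf
    have hxy_lt : ‖x - y‖ < δ / 4 * ‖x‖ := hxy ▸ hlt
    have hδx : δ / 4 * ‖x‖ ≤ 1 / 4 * ‖x‖ := by gcongr
    have hδy : δ * (3 / 4 * ‖x‖) ≤ δ * ‖y‖ := by gcongr; linarith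
    linarith [hxy_lt]
  have hle := h C hC y hdist
  rw [hy, norm_zero] at hle
  have hy₀ : ‖y‖ ≤ 0 := nonpos_of_mul_nonpos_right hle hη
  nlinarith [norm_nonneg x]

theorem exists_test_vector (h : IsQuantitativelyDense V δ η τ) (hδ : 0 < δ) (hη : 0 < η)
    (hV : V ≠ ⊥) {P : Finset (Fin n)} (hP : n - τ ≤ P.card) (u : EuclideanSpace ℝ (Fin n)) :
    ∃ z : EuclideanSpace ℝ (Fin n), ∀ x, ∀ v ∈ V,
      ‖z‖ / 2 ≤ ‖z - x‖ → ‖x - v‖ ≤ δ / 48 * ‖x‖ →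
        η / 32 * ‖coordRestrict P u‖ ≤ ‖coordRestrict P u - coordRestrict P x‖ := by
  have hC : (Pᶜ.card : ℝ) ≤ τ := by
    rw [Finset.card_compl, Fintype.card_fin, Nat.cast_sub (by simpa using P.card_le_univ)]
    linarith
  have hη₁ : η ≤ 1 := h.le_one hδ.le ((Nat.cast_nonneg _).trans hC) hV
  rcases Pᶜ.eq_empty_or_nonempty with hempty | hne
  · obtain rfl : P = Finset.univ := by simpa using hempty
    refine ⟨u, fun x v _ hx _ => ?_⟩
    change _ ≤ ‖coordRestrict Finset.univ (u - x)‖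
    rw [norm_coordRestrict_univ, norm_coordRestrict_univ]
    nlinarith [norm_nonneg u]
  · have hδ₁ := h.lt_one hη hC hne
    have himproved := (h.anti (half_le_self hδ.le)).max (h.half_quarter hδ.le hδ₁.le hη)
    obtain ⟨z, hz⟩ := exists_mem_forall_mul_norm_map_le (coordRestrictLin P)
      (norm_coordRestrict_le P) V (half_pos hδ).le
      (by linarith [le_max_right η (δ / 4)] : δ / 2 ≤ 2 * max η (δ / 4))
      (max_le hη₁ (by linarith))
      (fun x hx => (himproved Pᶜ hC x hx).trans_eq (by rw [compl_compl]; rfl)) u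
    refine ⟨z, fun x v hv hfar hclose => ?_⟩
    refine le_trans ?_ (hz x v hv hfar (hclose.trans_eq (by ring)))
    gcongr
    · exact le_max_left _ _
    · exact le_rfl

end IsQuantitativelyDense

end QuantitativeDensity

section SymmetricOperator

theorem map_eq_smul_of_map_map_eq_sq_smul {T : E →ₗ[ℝ] E} (hT : T.IsPositive) {s : ℝ}
    (hs : 0 < s) {x : E} (hx : T (T x) = s ^ 2 • x) : T x = s • x := by
  set y := T x - s • x with hy
  have hTy : T y = -(s • y) := by
    rw [hy, map_sub, map_smul, hx]
    module
  have hnonneg : 0 ≤ ⟪T y, y⟫ := hT.re_inner_nonneg_left y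
  rw [hTy, inner_neg_left, real_inner_smul_left, real_inner_self_eq_norm_sq] at hnonneg
  have hy₀ : ‖y‖ ^ 2 ≤ 0 := by nlinarith
  exact sub_eq_zero.1 (norm_eq_zero.1 (pow_eq_zero_iff two_ne_zero |>.1
    (le_antisymm hy₀ (sq_nonneg _))))

theorem norm_map_le_of_orthonormalBasis {ι : Type*} [Fintype ι] {b : OrthonormalBasis ι ℝ E}
    {σ : ι → ℝ} {A : E →L[ℝ] E} (hA : ∀ i, A (b i) = σ i • b i) {β : ℝ} (hβ : 0 ≤ β) {w : E}
    (hw : ∀ i, ⟪b i, w⟫ ≠ 0 → |σ i| ≤ β) : ‖A w‖ ≤ β * ‖w‖ := by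
  rw [← sq_le_sq₀ (norm_nonneg _) (by positivity), mul_pow, ← b.sum_sq_inner_right,
    ← b.sum_sq_inner_right, Finset.mul_sum]
  refine Finset.sum_le_sum fun i _ => ?_
  rw [inner_orthonormalBasis_map hA, mul_pow]
  rcases eq_or_ne ⟪b i, w⟫ 0 with h | h
  · simp [h]
  · gcongr ?_ * _
    exact sq_le_sq' (abs_le.1 (hw i h)).1 (abs_le.1 (hw i h)).2

theorem exists_mem_norm_map_sub_sq_le {V : Submodule ℝ E} [V.HasOrthogonalProjection]
    {A : E →L[ℝ] E} (hA : A.toLinearMap.IsSymmetric) {α β K : ℝ} (hα : α ≠ 0) (hK : 0 ≤ K)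
    (hV : ∀ v ∈ V, A v = α • v) (hVo : ∀ w ∈ Vᗮ, ‖A w‖ ≤ β * ‖w‖) {w : E}
    (hw : ‖Vᗮ.starProjection w‖ ^ 2 ≤ K * ‖V.starProjection w‖ ^ 2) :
    ∃ v ∈ V, ‖A w - v‖ ^ 2 ≤ β ^ 2 * K / α ^ 2 * ‖A w‖ ^ 2 := by
  set p := V.starProjection w
  set q := Vᗮ.starProjection w
  have hp : p ∈ V := V.starProjection_apply_mem w
  have hq : q ∈ Vᗮ := Vᗮ.starProjection_apply_mem w
  have hAw : A w = α • p + A q := by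
    rw [← hV p hp, ← map_add, V.starProjection_add_starProjection_orthogonal]
  have horth : ⟪α • p, A q⟫ = 0 := by
    rw [← ContinuousLinearMap.coe_coe, ← hA, ContinuousLinearMap.coe_coe, map_smul, hV p hp]
    exact Submodule.inner_right_of_mem_orthogonal (V.smul_mem _ (V.smul_mem _ hp)) hq
  refine ⟨α • p, V.smul_mem α hp, ?_⟩
  have hpyth : ‖A w‖ ^ 2 = α ^ 2 * ‖p‖ ^ 2 + ‖A q‖ ^ 2 := by
    rw [hAw, norm_add_sq_real, horth, norm_smul, mul_pow, Real.norm_eq_abs, sq_abs]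
    ring
  calc ‖A w - α • p‖ ^ 2 = ‖A q‖ ^ 2 := by rw [hAw, add_sub_cancel_left]
    _ ≤ (β * ‖q‖) ^ 2 := by gcongr; exact hVo q hq
    _ ≤ β ^ 2 * (K * ‖p‖ ^ 2) := by rw [mul_pow]; gcongr
    _ = β ^ 2 * K / α ^ 2 * (α ^ 2 * ‖p‖ ^ 2) := by field_simp
    _ ≤ β ^ 2 * K / α ^ 2 * ‖A w‖ ^ 2 := by
        rw [hpyth]
        gcongr
        exact le_add_of_nonneg_right (sq_nonneg _)

end SymmetricOperator

section Covariance

open scoped MatrixOrder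

variable {ι : Type*} [DecidableEq ι] {Θ S : Matrix ι ι ℝ}

theorem posDef_add_smul_one (hΘ : Θ.PosSemidef) {ε : ℝ} (hε : 0 < ε) :
    (Θ + ε • (1 : Matrix ι ι ℝ)).PosDef :=
  Matrix.PosDef.posSemidef_add hΘ (Matrix.PosDef.one.smul hε)

variable [Fintype ι] {x : EuclideanSpace ℝ ι}

/-- The positive square root of a covariance matrix `S` as an operator on Euclidean space; it
carries the standard Gaussian measure to `N(0, S)`. -/
noncomputable def covarianceSqrt (S : Matrix ι ι ℝ) :
    EuclideanSpace ℝ ι →L[ℝ] EuclideanSpace ℝ ι :=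
  Matrix.toEuclideanCLM (𝕜 := ℝ) (CFC.sqrt S)

theorem isPositive_covarianceSqrt (S : Matrix ι ι ℝ) :
    (covarianceSqrt S).toLinearMap.IsPositive :=
  Matrix.isPositive_toEuclideanLin_iff.2 (Matrix.nonneg_iff_posSemidef.1 (CFC.sqrt_nonneg S))

theorem covarianceSqrt_covarianceSqrt_apply (hS : S.PosSemidef) (x : EuclideanSpace ℝ ι) :
    covarianceSqrt S (covarianceSqrt S x) = Matrix.toEuclideanLin S x := by
  rw [covarianceSqrt, ← mul_apply_eq_comp, ← map_mul,
    CFC.sqrt_mul_sqrt_self S (Matrix.nonneg_iff_posSemidef.2 hS)]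
  rfl

theorem toEuclideanLin_inv_apply_eq_smul {M : Matrix ι ι ℝ} (hM : IsUnit M) {c : ℝ} (hc : c ≠ 0)
    (hx : Matrix.toEuclideanLin M x = c • x) : Matrix.toEuclideanLin M⁻¹ x = c⁻¹ • x := by
  have hinv : Matrix.toEuclideanLin M⁻¹ (Matrix.toEuclideanLin M x) = x := by
    simp [Matrix.toLpLin_apply, Matrix.nonsing_inv_mul _ ((Matrix.isUnit_iff_isUnit_det _).1 hM)]
  rw [hx, map_smul] at hinv
  rw [eq_inv_smul_iff₀ hc, hinv]

theorem covarianceSqrt_inv_add_smul_one_apply (hΘ : Θ.PosSemidef) {ε μ : ℝ} (hε : 0 < ε)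
    (hμ : 0 ≤ μ) (hx : Matrix.toEuclideanLin Θ x = μ • x) :
    covarianceSqrt (Θ + ε • (1 : Matrix ι ι ℝ))⁻¹ x = (√(μ + ε))⁻¹ • x := by
  have hμε : 0 < μ + ε := by positivity
  have hM := posDef_add_smul_one hΘ hε
  have hMx : Matrix.toEuclideanLin (Θ + ε • (1 : Matrix ι ι ℝ)) x = (μ + ε) • x := by
    rw [map_add, map_smul, LinearMap.add_apply, hx, add_smul]
    simp
  refine map_eq_smul_of_map_map_eq_sq_smul (isPositive_covarianceSqrt _)
    (by positivity) ?_
  rw [inv_pow, Real.sq_sqrt hμε.le, ← toEuclideanLin_inv_apply_eq_smul hM.isUnit hμε.ne' hMx]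
  exact covarianceSqrt_covarianceSqrt_apply hM.inv.posSemidef x

theorem gaussianSamples_eq_map (m : ℕ) {n : ℕ} (S : Matrix (Fin n) (Fin n) ℝ) :
    gaussianSamples m S = (gaussianFamily (Fin m) (EuclideanSpace ℝ (Fin n))).map
      fun G k => covarianceSqrt S (G k) := by
  have hlaw : multivariateGaussian 0 S = (stdGaussian _).map (covarianceSqrt S) := by
    simp [multivariateGaussian, covarianceSqrt]
  rw [gaussianSamples, gaussianFamily,
    Measure.pi_map_pi fun _ => Measurable.aemeasurable (by fun_prop), hlaw]

end Covariance

section Spectrum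

variable {n : ℕ} {Θ : Matrix (Fin n) (Fin n) ℝ}

theorem toEuclideanLin_eigenvectorBasis (hΘ : Θ.IsHermitian) (i : Fin n) :
    Matrix.toEuclideanLin Θ (hΘ.eigenvectorBasis i) =
      hΘ.eigenvalues i • hΘ.eigenvectorBasis i :=
  WithLp.ofLp_injective 2 (by simpa using hΘ.mulVec_eigenvectorBasis i)

theorem eigenvectorBasis_mem_euclideanKer (hΘ : Θ.IsHermitian) {i : Fin n}
    (hi : hΘ.eigenvalues i = 0) : hΘ.eigenvectorBasis i ∈ euclideanKer Θ := by
  rw [euclideanKer, LinearMap.mem_ker, toEuclideanLin_eigenvectorBasis, hi, zero_smul]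

theorem finrank_euclideanKer (hΘ : Θ.IsHermitian) :
    Module.finrank ℝ (euclideanKer Θ) =
      (Finset.univ.filter fun i => hΘ.eigenvalues i = 0).card := by
  have hrank := (Matrix.toEuclideanLin Θ).finrank_range_add_finrank_ker
  have hLin : Matrix.toEuclideanLin Θ = Matrix.toLin (PiLp.basisFun 2 ℝ (Fin n))
      (PiLp.basisFun 2 ℝ (Fin n)) Θ := LinearEquiv.congr_fun (Matrix.toLpLin_eq_toLin 2 2) Θ
  have hsplit := Finset.card_filter_add_card_filter_not (s := Finset.univ)
    fun i => hΘ.eigenvalues i = 0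
  rw [hLin, ← Matrix.rank_eq_finrank_range_toLin, hΘ.rank_eq_card_non_zero_eigs, ← hLin,
    finrank_euclideanSpace, Fintype.card_subtype] at hrank
  rw [euclideanKer]
  simp only [ne_eq, Finset.card_univ] at hrank hsplit
  omega

theorem IsMinNonzeroEigenvalue.le_eigenvalues {lam : ℝ} (h : IsMinNonzeroEigenvalue Θ lam)
    (hΘ : Θ.IsHermitian) {i : Fin n} (hi : hΘ.eigenvalues i ≠ 0) : lam ≤ hΘ.eigenvalues i :=
  h.2 ⟨hi, Module.End.hasEigenvalue_of_hasEigenvector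
    ⟨Module.End.mem_eigenspace_iff.2 (toEuclideanLin_eigenvectorBasis hΘ i),
      hΘ.eigenvectorBasis.orthonormal.ne_zero i⟩⟩

theorem toLp_transpose_designMatrix_mulVec {m : ℕ} (X : Fin m → EuclideanSpace ℝ (Fin n))
    (a : Fin m → ℝ) :
    WithLp.toLp 2 (Matrix.mulVec (Matrix.transpose (designMatrix X)) a) = ∑ k, a k • X k := by
  ext i
  simp [Matrix.mulVec, dotProduct, designMatrix, mul_comm]

end Spectrum

section KernelDirections

variable {n : ℕ} {Θ : Matrix (Fin n) (Fin n) ℝ} {ε lam : ℝ}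

theorem IsMinNonzeroEigenvalue.pos (h : IsMinNonzeroEigenvalue Θ lam) (hΘ : Θ.PosSemidef) :
    0 < lam :=
  (eigenvalue_nonneg_of_nonneg h.1.2
    (Matrix.isPositive_toEuclideanLin_iff.2 hΘ).re_inner_nonneg_right).lt_of_ne' h.1.1

theorem covarianceSqrt_eigenvectorBasis (hΘ : Θ.PosSemidef) (hε : 0 < ε) (i : Fin n) :
    covarianceSqrt (Θ + ε • (1 : Matrix (Fin n) (Fin n) ℝ))⁻¹ (hΘ.isHermitian.eigenvectorBasis i) =
      (√(hΘ.isHermitian.eigenvalues i + ε))⁻¹ • hΘ.isHermitian.eigenvectorBasis i :=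
  covarianceSqrt_inv_add_smul_one_apply hΘ hε (hΘ.eigenvalues_nonneg i)
    (toEuclideanLin_eigenvectorBasis hΘ.isHermitian i)

theorem norm_covarianceSqrt_le_of_mem_orthogonal (hΘ : Θ.PosSemidef)
    (hlam : IsMinNonzeroEigenvalue Θ lam) (hε : 0 < ε) {w : EuclideanSpace ℝ (Fin n)}
    (hw : w ∈ (euclideanKer Θ)ᗮ) :
    ‖covarianceSqrt (Θ + ε • (1 : Matrix (Fin n) (Fin n) ℝ))⁻¹ w‖ ≤ (√lam)⁻¹ * ‖w‖ := by
  have hlam₀ := hlam.pos hΘ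
  refine norm_map_le_of_orthonormalBasis (covarianceSqrt_eigenvectorBasis hΘ hε) (by positivity)
    fun i hi => ?_
  have hle : lam ≤ hΘ.isHermitian.eigenvalues i :=
    hlam.le_eigenvalues hΘ.isHermitian fun hzero =>
      hi (hw _ (eigenvectorBasis_mem_euclideanKer hΘ.isHermitian hzero))
  rw [abs_of_nonneg (by positivity)]
  gcongr
  linarith

theorem exists_mem_euclideanKer_norm_covarianceSqrt_sub_le (hΘ : Θ.PosSemidef)
    (hlam : IsMinNonzeroEigenvalue Θ lam) (hε : 0 < ε) {K θ : ℝ} (hK : 0 ≤ K) (hθ : 0 ≤ θ)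
    (hKθ : K * ε ≤ θ ^ 2 * lam) {w : EuclideanSpace ℝ (Fin n)}
    (hw : ‖(euclideanKer Θ)ᗮ.starProjection w‖ ^ 2 ≤
      K * ‖(euclideanKer Θ).starProjection w‖ ^ 2) :
    ∃ v ∈ euclideanKer Θ,
      ‖covarianceSqrt (Θ + ε • (1 : Matrix (Fin n) (Fin n) ℝ))⁻¹ w - v‖ ≤
        θ * ‖covarianceSqrt (Θ + ε • (1 : Matrix (Fin n) (Fin n) ℝ))⁻¹ w‖ := by
  have hker (v) (hv : v ∈ euclideanKer Θ) :
      covarianceSqrt (Θ + ε • (1 : Matrix (Fin n) (Fin n) ℝ))⁻¹ v = (√ε)⁻¹ • v := by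
    simpa using covarianceSqrt_inv_add_smul_one_apply hΘ hε le_rfl
      ((LinearMap.mem_ker.1 hv).trans (zero_smul ℝ v).symm)
  obtain ⟨v, hv, hle⟩ := exists_mem_norm_map_sub_sq_le (isPositive_covarianceSqrt _).isSymmetric
    (by positivity) hK hker (fun _ => norm_covarianceSqrt_le_of_mem_orthogonal hΘ hlam hε) hw
  refine ⟨v, hv, (sq_le_sq₀ (norm_nonneg _) (by positivity)).1 (hle.trans ?_)⟩
  have hlam₀ := hlam.pos hΘ
  rw [inv_pow, inv_pow, Real.sq_sqrt hε.le, Real.sq_sqrt hlam₀.le, mul_pow]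
  gcongr
  rw [div_inv_eq_mul, inv_mul_eq_div, div_mul_eq_mul_div]
  exact (div_le_iff₀ hlam₀).2 hKθ

theorem gaussianFamily_exists_norm_sub_covarianceSqrt_lt_le (hΘ : Θ.PosSemidef) (hε : 0 < ε)
    (hker : euclideanKer Θ ≠ ⊥) {κ : Type*} [Fintype κ] (u : EuclideanSpace ℝ (Fin n)) :
    (gaussianFamily κ (EuclideanSpace ℝ (Fin n))).real {G | ∃ a : κ → ℝ,
        ‖u - covarianceSqrt (Θ + ε • (1 : Matrix (Fin n) (Fin n) ℝ))⁻¹ (∑ k, a k • G k)‖ <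
          ‖u‖ / 2} ≤
      4 * Fintype.card κ / (3 * Module.finrank ℝ (euclideanKer Θ)) := by
  rw [← Submodule.one_le_finrank_iff] at hker
  rw [finrank_euclideanKer hΘ.isHermitian] at hker ⊢
  refine gaussianFamily_exists_norm_sub_map_lt_le (covarianceSqrt_eigenvectorBasis hΘ hε)
    (fun i => by positivity) (Finset.card_pos.1 hker) (fun i hi j => ?_) u
  rw [(Finset.mem_filter.1 hi).2, zero_add]
  have hj := hΘ.eigenvalues_nonneg j
  gcongr
  linarith

end KernelDirections

theorem mainTheorem8_general {n m : ℕ} {Θ : Matrix (Fin n) (Fin n) ℝ} {lam ε δ η τ : ℝ}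
    (hΘ : Θ.PosSemidef) (hlam : IsMinNonzeroEigenvalue Θ lam) (hε : 0 < ε) (hδ : 0 < δ)
    (hη : 0 < η) (hεle : ε ≤ Real.exp (-5) / (8 * 48 ^ 2) * δ ^ 2 * lam / n)
    (hr : 2 * m < Module.finrank ℝ (euclideanKer Θ))
    (hdense : IsQuantitativelyDense (euclideanKer Θ) δ η τ) (u : EuclideanSpace ℝ (Fin n))
    {P : Finset (Fin n)} (hP : n - τ ≤ P.card) :
    1 - 4 * m / (3 * Module.finrank ℝ (euclideanKer Θ)) - Real.exp (-m) ≤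
      (gaussianSamples m (Θ + ε • (1 : Matrix (Fin n) (Fin n) ℝ))⁻¹).real
        {X | η / 32 * ‖coordRestrict P u‖ ≤ ⨅ a : Fin m → ℝ,
          ‖coordRestrict P u - coordRestrict P
            (WithLp.toLp 2 (Matrix.mulVec (Matrix.transpose (designMatrix X)) a))‖} := by
  have hker : euclideanKer Θ ≠ ⊥ := Submodule.one_le_finrank_iff.1 (by omega)
  have hn : 0 < (n : ℝ) := by
    have hle : Module.finrank ℝ (euclideanKer Θ) ≤ n := by
      simpa using (euclideanKer Θ).finrank_le
    exact_mod_cast (by omega)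
  obtain ⟨z, hz⟩ := hdense.exists_test_vector hδ hη hker hP u
  have hKε : 8 * n * Real.exp 5 * ε ≤ (δ / 48) ^ 2 * lam := by
    calc 8 * n * Real.exp 5 * ε
        ≤ 8 * n * Real.exp 5 * (Real.exp (-5) / (8 * 48 ^ 2) * δ ^ 2 * lam / n) := by gcongr
      _ = (δ / 48) ^ 2 * lam := by rw [Real.exp_neg]; field_simp
  have hdist := gaussianFamily_exists_norm_sub_covarianceSqrt_lt_le (κ := Fin m) hΘ hε hker z
  have hratio := gaussianFamily_exists_projection_ratio_le (euclideanKer Θ) hr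
  rw [Fintype.card_fin] at hdist
  rw [finrank_euclideanSpace_fin] at hratio
  rw [gaussianSamples_eq_map]
  refine (sub_le_sub (sub_le_sub_left hdist 1) hratio).trans ?_
  refine (one_sub_measureReal_sub_measureReal_le ?_).trans
    (measureReal_preimage_le_map (Measurable.aemeasurable (by fun_prop)) _)
  rintro G ⟨hGz, hGV⟩
  rw [Set.mem_preimage, Set.mem_ofPred_eq]
  refine le_ciInf fun a => ?_
  obtain ⟨v, hv, hclose⟩ := exists_mem_euclideanKer_norm_covarianceSqrt_sub_le hΘ hlam hε
    (by positivity) (by positivity) hKε (not_lt.1 fun hlt => hGV ⟨a, hlt⟩)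
  rw [toLp_transpose_designMatrix_mulVec]
  simp only [← map_smul, ← map_sum]
  exact hz _ v hv (not_lt.1 fun hlt => hGz ⟨a, hlt⟩) hclose

theorem mainTheorem8 :
    ∃ c C κ : ℝ, 0 < c ∧ 0 < C ∧ 0 < κ ∧
      ∀ (n m : ℕ) (Θ : Matrix (Fin n) (Fin n) ℝ) (lam ε δ η τ : ℝ),
        Θ.PosSemidef → IsMinNonzeroEigenvalue Θ lam →
        0 < ε → 0 < δ → 0 < η → 0 < τ →
        C * Real.log (n : ℝ) ≤ (m : ℝ) →
        ε ≤ c * δ ^ 2 * lam / (n : ℝ) →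
        2 * m < Module.finrank ℝ (euclideanKer Θ) →
        IsQuantitativelyDense (euclideanKer Θ) δ η τ →
        ∀ (u : EuclideanSpace ℝ (Fin n)) (P : Finset (Fin n)),
          (n : ℝ) - τ ≤ (P.card : ℝ) →
          1 - 4 * (m : ℝ) / (3 * (Module.finrank ℝ (euclideanKer Θ) : ℝ))
              - Real.exp (-(κ * (m : ℝ))) ≤
            (gaussianSamples m (Θ + ε • (1 : Matrix (Fin n) (Fin n) ℝ))⁻¹).real
              {X | η / 32 * ‖coordRestrict P u‖ ≤
                ⨅ a : Fin m → ℝ,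
                  ‖coordRestrict P u -
                    coordRestrict P (WithLp.toLp 2
                      (Matrix.mulVec (Matrix.transpose (designMatrix X)) a))‖} :=
  ⟨Real.exp (-5) / (8 * 48 ^ 2), 1, 1, by positivity, one_pos, one_pos,
    fun _ _ _ _ _ _ _ _ hΘ hlam hε hδ hη _ _ hεle hr hdense u _ hP => by
      simpa using mainTheorem8_general hΘ hlam hε hδ hη hεle hr hdense u hP⟩
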